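/- A digraph here has no loops, no parallel arcs and no pairs of opposite arcs; it is $n$-chromatic if its underlying graph has chromatic number exactly $n$. For integers $k,l\ge 1$, let $P^+(k,l)$ be the oriented path on $k+l+1$ distinct vertices $x_0,\dots,x_{k+l}$ whose arcs are $x_0\to x_1\to\cdots\to x_k$ and $x_{k+l}\to x_{k+l-1}\to\cdots\to x_k$, and let $P^-(k,l)$ be the path obtained from it by reversing all arcs. A digraph contains a digraph $H$ if it has a (not necessarily induced) subdigraph isomorphic to $H$. **Theorem 3.6.** Let $k,l\ge 1$ and $n$ be integers with $k+l=n-1\ge 3$. Then every $n$-chromatic digraph contains $P^+(k,l)$ and $P^-(k,l)$; that is, it contains every oriented path with two blocks of lengths $k$ and $l$. -/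

import Mathlib

namespace TwoBlock

/-- A digraph without loops and without pairs of opposite arcs. -/
def IsOriented {V : Type*} (D : Digraph V) : Prop :=
  ∀ x y : V, D.Adj x y → ¬ D.Adj y x

/-- `D` is `n`-chromatic: its underlying simple graph has chromatic number exactly `n`. -/
def IsChromatic {V : Type*} (D : Digraph V) (n : ℕ) : Prop :=
  D.toSimpleGraphInclusive.chromaticNumber = (n : ℕ∞)

/-- `D` contains a copy of `H`: there is an injective morphism of digraphs from `H` to `D`. -/
def Contains {V W : Type*} (D : Digraph V) (H : Digraph W) : Prop :=
  ∃ f : W → V, Function.Injective f ∧ ∀ x y : W, H.Adj x y → D.Adj (f x) (f y)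

/-- The oriented path `P⁺(k, l)` on the vertices `0, 1, …, k + l`, with arcs
`0 → 1 → ⋯ → k` (first block, of length `k`) and
`k ← k + 1 ← ⋯ ← k + l` (second block, of length `l`). -/
def pathPos (k l : ℕ) : Digraph (Fin (k + l + 1)) where
  Adj i j := (j.val = i.val + 1 ∧ j.val ≤ k) ∨ (i.val = j.val + 1 ∧ k ≤ j.val)

/-- The oriented path `P⁻(k, l)` on the vertices `0, 1, …, k + l`, with arcs
`0 ← 1 ← ⋯ ← k` (first block, of length `k`) and
`k → k + 1 → ⋯ → k + l` (second block, of length `l`). -/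
def pathNeg (k l : ℕ) : Digraph (Fin (k + l + 1)) where
  Adj i j := (i.val = j.val + 1 ∧ i.val ≤ k) ∨ (j.val = i.val + 1 ∧ k ≤ i.val)

end TwoBlock

/-! Put `K = k - 1` and `L = l - 1`; the blocks are interchangeable, so let `K ≤ L`. Reversing all
arcs handles `P⁻`, and compactness reduces to finite digraphs. A finite digraph without `P⁺(k, l)`
is then coloured with `K + L + 2` colours. The one obstruction used throughout is `BlockFree`: a
vertex cannot have in-neighbours ending disjoint paths with `K` and `L` arcs that avoid it.

Remove a maximal disjoint family of hubs, modelled on shortest circuits of length at least `L + 2`.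
The rest has only circuits of length at most `L + 1`. In a spanning out-forest of it with maximal
total level, every arc rises in level or returns to an ancestor. Colour a vertex by its level below
`K`, and by `K` plus the residue of `lev - K` modulo `L + 2` from level `K` on: a clash would need a
long rising arc, which is forbidden, or a long circuit.

Distinct hubs are not adjacent. A hub without its apex takes the top `L + 1` colours
(`exists_potential`, `exists_hub`), and the apex takes the colour `height ≤ K`, just above the
levels of its in-neighbours. Its out-neighbours on that level clash, so they and whatever they reach
by one-level steps are raised: their colours shift by one below level `K`, and by a permutation of
the residues from `K` on. `exists_free_shade` lets this permutation avoid the hub colours, and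
`root_not_hubAdj` with `root_isRaised_iff` makes it consistent across trees. -/

namespace TwoBlock

/-! ### Directed paths confined to a vertex set -/

variable {V : Type*}

/-- `EndsPath D n S x`: some directed path with `n` arcs, all of whose vertices lie in `S`,
ends at `x`. -/
def EndsPath (D : Digraph V) : ℕ → Set V → V → Prop
  | 0, S, x => x ∈ S
  | n + 1, S, x => x ∈ S ∧ ∃ w, D.Adj w x ∧ EndsPath D n (S \ {x}) w

namespace EndsPath

variable {D : Digraph V} {m n : ℕ} {S T : Set V} {x y : V}

theorem mem (h : EndsPath D n S x) : x ∈ S := by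
  cases n with
  | zero => exact h
  | succ n => exact h.1

theorem mono (h : EndsPath D n S x) (hST : S ⊆ T) : EndsPath D n T x := by
  induction n generalizing S T x with
  | zero => exact hST h
  | succ n ih =>
    obtain ⟨hx, w, hw, hp⟩ := h
    exact ⟨hST hx, w, hw, ih hp (Set.sdiff_subset_sdiff_left hST)⟩

theorem of_succ (h : EndsPath D (n + 1) S x) : EndsPath D n S x := by
  induction n generalizing S x with
  | zero => exact h.1
  | succ n ih =>
    obtain ⟨hx, w, hw, hp⟩ := h
    exact ⟨hx, w, hw, ih hp⟩

theorem of_le (h : EndsPath D n S x) (hmn : m ≤ n) : EndsPath D m S x := by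
  induction hmn with
  | refl => exact h
  | step _ ih => exact ih h.of_succ

theorem snoc (h : EndsPath D n S x) (hxy : D.Adj x y) (hy : y ∉ S) :
    EndsPath D (n + 1) (insert y S) y :=
  ⟨Set.mem_insert _ _, x, hxy, h.mono fun _ hz =>
    ⟨Set.mem_insert_of_mem _ hz, fun hzy => hy (hzy ▸ hz)⟩⟩

theorem exists_seq (h : EndsPath D n S x) :
    ∃ f : ℕ → V, f 0 = x ∧ (∀ i ≤ n, f i ∈ S) ∧ Set.InjOn f (Set.Iic n) ∧
      ∀ i < n, D.Adj (f (i + 1)) (f i) := by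
  induction n generalizing S x with
  | zero =>
    refine ⟨fun _ => x, rfl, fun _ _ => h, ?_, fun i hi => absurd hi (by omega)⟩
    intro a ha b hb _
    simp only [Set.mem_Iic] at ha hb
    omega
  | succ n ih =>
    obtain ⟨hx, w, hw, hp⟩ := h
    obtain ⟨f, f0, fS, finj, fadj⟩ := ih hp
    refine ⟨fun i => if i = 0 then x else f (i - 1), by simp, ?_, ?_, ?_⟩
    · intro i hi
      rcases i with _ | i
      · simpa using hx
      · simpa using (fS i (by omega)).1
    · intro a ha b hb hab
      simp only [Set.mem_Iic] at ha hb
      rcases a with _ | a <;> rcases b with _ | b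
      · rfl
      · exact absurd (by simpa using hab.symm) (fS b (by omega)).2
      · exact absurd (by simpa using hab) (fS a (by omega)).2
      · have := finj (by simp; omega) (by simp; omega) (by simpa using hab : f a = f b)
        omega
    · intro i hi
      rcases i with _ | i
      · simpa [f0] using hw
      · simpa using fadj i (by omega)

theorem of_seq (f : ℕ → V) (hS : ∀ i ≤ n, f i ∈ S) (hinj : Set.InjOn f (Set.Iic n))
    (hadj : ∀ i < n, D.Adj (f i) (f (i + 1))) : EndsPath D n S (f n) := by
  induction n generalizing S with
  | zero => exact hS 0 le_rfl
  | succ n ih =>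
    refine ⟨hS _ le_rfl, f n, hadj n (by omega), ih ?_ ?_ ?_⟩
    · intro i hi
      refine ⟨hS i (by omega), fun h => ?_⟩
      have := hinj (by simp; omega) (by simp) h
      omega
    · exact hinj.mono (Set.Iic_subset_Iic.2 (by omega))
    · exact fun i hi => hadj i (by omega)

end EndsPath

/-! ### Two disjoint directed paths make a two-block path -/

theorem contains_pathPos {D : Digraph V} {K L : ℕ} {S T : Set V} {x₁ x₂ y : V}
    (h₁ : D.Adj x₁ y) (h₂ : D.Adj x₂ y) (p₁ : EndsPath D K S x₁) (p₂ : EndsPath D L T x₂)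
    (hST : Disjoint S T) (hS : y ∉ S) (hT : y ∉ T) :
    Contains D (pathPos (K + 1) (L + 1)) := by
  obtain ⟨f, f0, fS, finj, fadj⟩ := p₁.exists_seq
  obtain ⟨g, g0, gT, ginj, gadj⟩ := p₂.exists_seq
  have hfg : ∀ i ≤ K, ∀ j ≤ L, f i ≠ g j := fun i hi j hj h =>
    Set.disjoint_left.1 hST (fS i hi) (h ▸ gT j hj)
  have hfy : ∀ i ≤ K, f i ≠ y := fun i hi h => hS (h ▸ fS i hi)
  have hgy : ∀ i ≤ L, g i ≠ y := fun i hi h => hT (h ▸ gT i hi)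
  let F : ℕ → V := fun i => if i ≤ K then f (K - i) else if i = K + 1 then y else g (i - K - 2)
  have F1 : ∀ i ≤ K, F i = f (K - i) := fun i hi => by simp [F, hi]
  have F2 : F (K + 1) = y := by simp [F]
  have F3 : ∀ i, F (K + 2 + i) = g i := fun i => by
    have h1 : ¬ (K + 2 + i ≤ K) := by omega
    have h2 : ¬ (K + 2 + i = K + 1) := by omega
    have h3 : K + 2 + i - K - 2 = i := by omega
    simp only [F, h1, h2, h3, if_false]
  have cases3 : ∀ i, i ≤ K ∨ i = K + 1 ∨ ∃ j, i = K + 2 + j := fun i => by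
    by_cases h : i ≤ K
    · exact Or.inl h
    · by_cases h' : i = K + 1
      · exact Or.inr (Or.inl h')
      · exact Or.inr (Or.inr ⟨i - (K + 2), by omega⟩)
  refine ⟨fun i => F i.val, ?_, ?_⟩
  · rintro ⟨a, ha⟩ ⟨b, hb⟩ hab
    simp only [Fin.mk.injEq] at hab ⊢
    rcases cases3 a with ha' | rfl | ⟨a, rfl⟩ <;> rcases cases3 b with hb' | rfl | ⟨b, rfl⟩
    · rw [F1 a ha', F1 b hb'] at hab
      have := finj (by simp) (by simp) hab
      omega
    · rw [F1 a ha', F2] at hab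
      exact absurd hab (hfy _ (by omega))
    · rw [F1 a ha', F3] at hab
      exact absurd hab (hfg _ (by omega) _ (by omega))
    · rw [F1 b hb', F2] at hab
      exact absurd hab.symm (hfy _ (by omega))
    · rfl
    · rw [F2, F3] at hab
      exact absurd hab.symm (hgy _ (by omega))
    · rw [F1 b hb', F3] at hab
      exact absurd hab.symm (hfg _ (by omega) _ (by omega))
    · rw [F2, F3] at hab
      exact absurd hab (hgy _ (by omega))
    · rw [F3, F3] at hab
      rw [ginj (by simp; omega) (by simp; omega) hab]
  · rintro ⟨a, ha⟩ ⟨b, hb⟩ hab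
    simp only [pathPos] at hab
    show D.Adj (F a) (F b)
    rcases hab with ⟨rfl, hk⟩ | ⟨rfl, hk⟩
    · by_cases h : a = K
      · subst h
        rw [F1 a le_rfl, F2, Nat.sub_self, f0]
        exact h₁
      · rw [F1 a (by omega), F1 (a + 1) (by omega)]
        have := fadj (K - (a + 1)) (by omega)
        rwa [show K - (a + 1) + 1 = K - a by omega] at this
    · obtain ⟨c, rfl⟩ := Nat.exists_eq_add_of_le hk
      rcases c with _ | c
      · rw [show K + 1 + 0 + 1 = K + 2 + 0 by omega, F3, g0]
        simpa [F2] using h₂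
      · rw [show K + 1 + (c + 1) + 1 = K + 2 + (c + 1) by omega,
          show K + 1 + (c + 1) = K + 2 + c by omega, F3, F3]
        exact gadj c (by omega)

/-- No two directed paths with `K` and `L` arcs, disjoint from each other, can be completed to a
copy of `P⁺(K + 1, L + 1)` by a common out-neighbour of their ends. -/
def BlockFree (D : Digraph V) (K L : ℕ) : Prop :=
  ∀ ⦃x₁ x₂ y : V⦄ ⦃S T : Set V⦄, D.Adj x₁ y → D.Adj x₂ y → EndsPath D K S x₁ →
    EndsPath D L T x₂ → Disjoint S T → y ∉ S → y ∉ T → False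

theorem BlockFree.symm {D : Digraph V} {K L : ℕ} (h : BlockFree D K L) : BlockFree D L K :=
  fun _ _ _ _ _ h₁ h₂ p₁ p₂ hST hS hT => h h₂ h₁ p₂ p₁ hST.symm hT hS

/-! ### Final spanning out-forests -/

/-- `p` and `lev` are the parent map and the level map of a spanning out-forest of `D[G]`, whose
roots have level `0`. -/
def IsForest (D : Digraph V) (G : Set V) (p : V → V) (lev : V → ℕ) : Prop :=
  ∀ x ∈ G, 0 < lev x → p x ∈ G ∧ D.Adj (p x) x ∧ lev (p x) + 1 = lev x

/-- The ancestors of `x` in the forest, `x` included. -/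
def anc (p : V → V) (lev : V → ℕ) (x : V) : Set V :=
  {y | ∃ t ≤ lev x, p^[t] x = y}

theorem mem_anc_self (p : V → V) (lev : V → ℕ) (x : V) : x ∈ anc p lev x :=
  ⟨0, Nat.zero_le _, rfl⟩

theorem parent_mem_anc {p : V → V} {lev : V → ℕ} {x : V} (h0 : 0 < lev x) :
    p x ∈ anc p lev x := ⟨1, h0, rfl⟩

namespace IsForest

variable {D : Digraph V} {G : Set V} {p : V → V} {lev : V → ℕ} {x y z : V}

theorem iterate (hF : IsForest D G p lev) (hx : x ∈ G) {t : ℕ} (ht : t ≤ lev x) :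
    p^[t] x ∈ G ∧ lev (p^[t] x) = lev x - t := by
  induction t with
  | zero => exact ⟨hx, rfl⟩
  | succ t ih =>
    obtain ⟨h1, h2⟩ := ih (by omega)
    obtain ⟨h3, -, h4⟩ := hF _ h1 (by omega)
    rw [Function.iterate_succ_apply']
    exact ⟨h3, by omega⟩

theorem anc_mem (hF : IsForest D G p lev) (hx : x ∈ G) (hy : y ∈ anc p lev x) : y ∈ G := by
  obtain ⟨t, ht, rfl⟩ := hy
  exact (hF.iterate hx ht).1

theorem lev_le (hF : IsForest D G p lev) (hx : x ∈ G) (hy : y ∈ anc p lev x) :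
    lev y ≤ lev x := by
  obtain ⟨t, ht, rfl⟩ := hy
  have := (hF.iterate hx ht).2
  omega

theorem eq_iterate (hF : IsForest D G p lev) (hx : x ∈ G) (hy : y ∈ anc p lev x) :
    p^[lev x - lev y] x = y := by
  obtain ⟨t, ht, rfl⟩ := hy
  rw [(hF.iterate hx ht).2, Nat.sub_sub_self ht]

theorem anc_trans (hF : IsForest D G p lev) (hx : x ∈ G) (hy : y ∈ anc p lev x)
    (hz : z ∈ anc p lev y) : z ∈ anc p lev x := by
  obtain ⟨t, ht, rfl⟩ := hy
  obtain ⟨s, hs, rfl⟩ := hz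
  have := (hF.iterate hx ht).2
  exact ⟨s + t, by omega, Function.iterate_add_apply _ _ _ _⟩

theorem anc_of_le (hF : IsForest D G p lev) (hx : x ∈ G) (hy : y ∈ anc p lev x)
    (hz : z ∈ anc p lev x) (hzy : lev z ≤ lev y) : z ∈ anc p lev y := by
  have h1 := hF.lev_le hx hy
  refine ⟨lev y - lev z, Nat.sub_le _ _, ?_⟩
  conv_rhs => rw [← hF.eq_iterate hx hz]
  conv_lhs => rw [← hF.eq_iterate hx hy]
  rw [← Function.iterate_add_apply, hF.eq_iterate hx hy]
  congr 2
  omega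

theorem eq_of_lev_eq (hF : IsForest D G p lev) (hx : x ∈ G) (hy : y ∈ anc p lev x)
    (hz : z ∈ anc p lev x) (hzy : lev z = lev y) : z = y := by
  rw [← hF.eq_iterate hx hz, ← hF.eq_iterate hx hy, hzy]

theorem adj_iterate (hF : IsForest D G p lev) (hx : x ∈ G) {t : ℕ} (ht : t < lev x) :
    D.Adj (p^[t + 1] x) (p^[t] x) := by
  obtain ⟨h1, h2⟩ := hF.iterate hx ht.le
  rw [Function.iterate_succ_apply']
  exact (hF _ h1 (by omega)).2.1

theorem iterate_inj (hF : IsForest D G p lev) (hx : x ∈ G) {s t : ℕ} (hs : s ≤ lev x)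
    (ht : t ≤ lev x) (h : p^[s] x = p^[t] x) : s = t := by
  have h1 := (hF.iterate hx hs).2
  have h2 := (hF.iterate hx ht).2
  rw [h] at h1
  omega

theorem endsPath (hF : IsForest D G p lev) (hx : x ∈ G) {j : ℕ} (hj : j ≤ lev x) :
    EndsPath D (lev x - j) {a | a ∈ anc p lev x ∧ j ≤ lev a} x := by
  have := EndsPath.of_seq (D := D) (n := lev x - j) (S := {a | a ∈ anc p lev x ∧ j ≤ lev a})
    (fun i => p^[lev x - j - i] x) ?_ ?_ ?_
  · simpa using this
  · intro i hi
    refine ⟨⟨_, by omega, rfl⟩, ?_⟩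
    have := (hF.iterate hx (t := lev x - j - i) (by omega)).2
    omega
  · intro a ha b hb hab
    simp only [Set.mem_Iic] at ha hb
    have := hF.iterate_inj hx (by omega) (by omega) hab
    omega
  · intro i hi
    have := hF.adj_iterate hx (t := lev x - j - (i + 1)) (by omega)
    rwa [show lev x - j - (i + 1) + 1 = lev x - j - i by omega] at this

theorem endsPath_of_le (hF : IsForest D G p lev) (hx : x ∈ G) {n : ℕ} (hn : n ≤ lev x) :
    EndsPath D n {a | a ∈ anc p lev x ∧ lev x - n ≤ lev a} x := by
  have := hF.endsPath hx (j := lev x - n) (by omega)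
  rwa [Nat.sub_sub_self hn] at this

theorem lev_lt_card [Finite V] (hF : IsForest D G p lev) (hx : x ∈ G) : lev x < Nat.card V := by
  have : Function.Injective (fun t : Fin (lev x + 1) => p^[t.val] x) := by
    intro a b hab
    exact Fin.ext (hF.iterate_inj hx (by omega) (by omega) hab)
  have := Nat.card_le_card_of_injective _ this
  simpa using this

end IsForest

/-- Every finite digraph `D[G]` has a spanning out-forest such that each arc either goes up in
level or ends at an ancestor of its start. -/
theorem exists_final_forest [Finite V] (D : Digraph V) (G : Set V) :
    ∃ (p : V → V) (lev : V → ℕ), IsForest D G p lev ∧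
      ∀ x ∈ G, ∀ y ∈ G, D.Adj x y → lev x < lev y ∨ y ∈ anc p lev x := by
  classical
  have := Fintype.ofFinite V
  -- Extremal choice: the total level is bounded, since levels are less than `Nat.card V`.
  let M : ℕ → Prop := fun N => ∃ (p : V → V) (lev : V → ℕ), IsForest D G p lev ∧
    ∑ x ∈ Finset.univ.filter (· ∈ G), lev x = N
  have hM0 : ∃ N, M N := ⟨_, id, fun _ => 0, fun x _ h => absurd h (lt_irrefl _), rfl⟩
  have hMb : ∀ N, M N → N ≤ Fintype.card V * Nat.card V := by
    rintro N ⟨p, lev, hF, rfl⟩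
    refine (Finset.sum_le_card_nsmul _ _ (Nat.card V) ?_).trans ?_
    · intro x hx
      exact (hF.lev_lt_card (by simpa using hx)).le
    · rw [smul_eq_mul]
      exact Nat.mul_le_mul_right _ (Finset.card_le_univ _)
  obtain ⟨N₀, hN₀⟩ := hM0
  have hspec := Nat.findGreatest_spec (P := M) (hMb _ hN₀) hN₀
  have hmax : ∀ N, M N → N ≤ Nat.findGreatest M (Fintype.card V * Nat.card V) :=
    fun N hN => Nat.le_findGreatest (hMb N hN) hN
  obtain ⟨p, lev, hF, hsum⟩ := hspec
  refine ⟨p, lev, hF, fun x hx y hy hxy => ?_⟩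
  by_contra! hcon
  obtain ⟨h1, h2⟩ := hcon
  -- Rehanging `y` below `x` creates no cycle, as `y` is not an ancestor of `x`. It raises the whole
  -- subtree of `y` by a positive amount, against maximality.
  let lev' : V → ℕ := fun z => if y ∈ anc p lev z then lev z + (lev x + 1 - lev y) else lev z
  have hle : ∀ z, lev z ≤ lev' z := fun z => by
    simp only [lev']; split_ifs <;> omega
  have hF' : IsForest D G (Function.update p y x) lev' := by
    intro z hz h0
    by_cases hzy : z = y
    · subst hzy
      simp only [Function.update_self, lev', mem_anc_self, h2, if_true, if_false]
      exact ⟨hx, hxy, by omega⟩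
    · rw [Function.update_of_ne hzy]
      by_cases hanc : y ∈ anc p lev z
      · obtain ⟨t, ht, hty⟩ := id hanc
        rcases t with _ | t
        · exact absurd hty hzy
        obtain ⟨h3, h4, h5⟩ := hF z hz (by omega)
        have h6 : y ∈ anc p lev (p z) := ⟨t, by omega, by
          rwa [Function.iterate_succ_apply] at hty⟩
        refine ⟨h3, h4, ?_⟩
        simp only [lev', hanc, h6, if_true]
        omega
      · have h0' : 0 < lev z := by simpa [lev', hanc] using h0
        obtain ⟨h3, h4, h5⟩ := hF z hz h0'
        have h6 : y ∉ anc p lev (p z) := by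
          rintro ⟨t, ht, hty⟩
          exact hanc ⟨t + 1, by omega, by rwa [Function.iterate_succ_apply]⟩
        refine ⟨h3, h4, ?_⟩
        simp only [lev', hanc, h6, if_false]
        omega
  have h7 := hmax _ ⟨_, _, hF', rfl⟩
  rw [← hsum] at h7
  refine absurd h7 (not_le.2 (Finset.sum_lt_sum (fun z _ => hle z) ⟨y, by simpa using hy, ?_⟩))
  simp only [lev', mem_anc_self, if_true]
  omega

/-! ### Circuits and hubs -/

/-- `h 0 → h 1 → ⋯ → h (M - 1) → h 0` is a circuit of length `M` in `D[S]`. -/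
structure IsCircuit (D : Digraph V) (S : Set V) (M : ℕ) (h : ℕ → V) : Prop where
  pos : 0 < M
  mem : ∀ i < M, h i ∈ S
  inj : Set.InjOn h (Set.Iio M)
  adj : ∀ i, i + 1 < M → D.Adj (h i) (h (i + 1))
  close : D.Adj (h (M - 1)) (h 0)

theorem exists_injOn_of_reflTransGen {R : V → V → Prop} {x y : V}
    (h : Relation.ReflTransGen R x y) :
    ∃ (n : ℕ) (f : ℕ → V), f 0 = x ∧ f n = y ∧ (∀ i < n, R (f i) (f (i + 1))) ∧
      Set.InjOn f (Set.Iic n) := by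
  induction h using Relation.ReflTransGen.head_induction_on with
  | refl =>
    refine ⟨0, fun _ => y, rfl, rfl, fun i hi => absurd hi (by omega), ?_⟩
    intro a ha b hb _
    simp only [Set.mem_Iic] at ha hb
    omega
  | @head a b hab _ ih =>
    obtain ⟨n, f, f0, fn, fR, finj⟩ := ih
    by_cases hex : ∃ i ≤ n, f i = a
    · obtain ⟨i, hi, hia⟩ := hex
      refine ⟨n - i, fun t => f (t + i), by simpa using hia, ?_, ?_, ?_⟩
      · simpa [Nat.sub_add_cancel hi] using fn
      · intro t ht
        have := fR (t + i) (by omega)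
        rwa [show t + i + 1 = t + 1 + i by omega] at this
      · intro s hs t ht hst
        simp only [Set.mem_Iic] at hs ht
        have := finj (by simp; omega) (by simp; omega) hst
        omega
    · push Not at hex
      refine ⟨n + 1, fun t => if t = 0 then a else f (t - 1), by simp, by simpa using fn, ?_, ?_⟩
      · intro t ht
        rcases t with _ | t
        · simpa [f0] using hab
        · simpa using fR t (by omega)
      · intro s hs t ht hst
        simp only [Set.mem_Iic] at hs ht
        rcases s with _ | s <;> rcases t with _ | t
        · rfl
        · exact absurd (by simpa using hst.symm) (hex t (by omega))
        · exact absurd (by simpa using hst) (hex s (by omega))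
        · have := finj (by simp; omega) (by simp; omega) (by simpa using hst : f s = f t)
          omega

theorem sub_one_ediv_of_not_dvd {a m : ℤ} (hm : 0 < m) (h : ¬ m ∣ a) : (a - 1) / m = a / m := by
  have h1 := Int.mul_ediv_add_emod a m
  have h2 : 0 < a % m := lt_of_le_of_ne (Int.emod_nonneg _ hm.ne') fun h0 =>
    h (Int.dvd_of_emod_eq_zero h0.symm)
  have h3 := Int.emod_lt_of_pos a hm
  refine (Int.ediv_emod_unique (r := a % m - 1) hm).2 ⟨by omega, by omega, by omega⟩ |>.1

/-- If the strongly connected digraph `D[C]` (spanned by a closed walk `g`) has no circuit of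
length `1` modulo `m`, then it has a proper colouring with `m` colours. -/
theorem exists_potential (D : Digraph V) {m N : ℕ} (hm : 0 < m) {g : ℕ → V} (hN : 0 < N)
    (hper : ∀ n, g (n + N) = g n) (hg : ∀ n, D.Adj (g n) (g (n + 1)))
    (hno : ∀ M h, IsCircuit D (Set.range g) M h → ¬ M ≡ 1 [MOD m]) :
    ∃ π : V → ℤ, ∀ x ∈ Set.range g, ∀ y ∈ Set.range g, D.Adj x y → ¬ (m : ℤ) ∣ π x - π y := by
  classical
  have hm' : (0 : ℤ) < m := by exact_mod_cast hm
  -- The integer ceiling of `(1 + π y - π x) / m`.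
  let w : (V → ℤ) → V → V → ℤ := fun π x y => -((π x - π y - 1) / m)
  have hw : ∀ π x y, 1 + π y - π x ≤ m * w π x y := fun π x y => by
    have := Int.mul_ediv_self_le (x := π x - π y - 1) hm'.ne'
    simp only [w, mul_neg]
    linarith
  let P : Finset (ℕ × ℕ) :=
    (Finset.range N ×ˢ Finset.range N).filter fun q => D.Adj (g q.1) (g q.2)
  -- Each arc is closed up by a return walk along `g`. Around a closed walk the potentials
  -- telescope, so `m` times the sum of `w` is at least the length; hence `Φ` is bounded below and
  -- has a minimiser.
  let Φ : (V → ℤ) → ℤ := fun π => ∑ q ∈ P, (w π (g q.1) (g q.2) +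
    ∑ s ∈ Finset.range (q.1 + N - q.2), w π (g (q.2 + s)) (g (q.2 + s + 1)))
  have hΦ : ∀ π, 0 ≤ Φ π := fun π => by
    refine Finset.sum_nonneg fun q hq => ?_
    simp only [P, Finset.mem_filter, Finset.mem_product, Finset.mem_range] at hq
    refine nonneg_of_mul_nonneg_right (a := (m : ℤ)) ?_ hm'
    rw [mul_add, Finset.mul_sum]
    have h1 := hw π (g q.1) (g q.2)
    have h2 : ∑ s ∈ Finset.range (q.1 + N - q.2),
        (1 + (π (g (q.2 + (s + 1))) - π (g (q.2 + s)))) ≤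
        ∑ s ∈ Finset.range (q.1 + N - q.2), m * w π (g (q.2 + s)) (g (q.2 + s + 1)) :=
      Finset.sum_le_sum fun s _ => by
        have := hw π (g (q.2 + s)) (g (q.2 + s + 1))
        rw [← add_assoc]
        linarith
    rw [Finset.sum_add_distrib, Finset.sum_range_sub (fun s => π (g (q.2 + s))),
      show q.2 + (q.1 + N - q.2) = q.1 + N by omega, hper] at h2
    simp only [Finset.sum_const, Finset.card_range, nsmul_eq_mul, mul_one, add_zero] at h2
    have h3 : (0 : ℤ) ≤ ((q.1 + N - q.2 : ℕ) : ℤ) := Int.natCast_nonneg _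
    linarith
  obtain ⟨π, hmin⟩ : ∃ π, ∀ π', Φ π ≤ Φ π' := by
    have hex : ∃ n : ℕ, ∃ π, (Φ π).toNat = n := ⟨_, fun _ => 0, rfl⟩
    obtain ⟨π, hπ⟩ := Nat.find_spec hex
    refine ⟨π, fun π' => ?_⟩
    have h1 := Nat.find_min' hex ⟨π', rfl⟩
    rw [← hπ] at h1
    have h2 := hΦ π
    have h3 := hΦ π'
    omega
  refine ⟨π, fun x hx y hy hxy hdvd => ?_⟩
  let R : V → V → Prop := fun a b =>
    a ∈ Set.range g ∧ b ∈ Set.range g ∧ D.Adj a b ∧ (m : ℤ) ∣ π a - π b - 1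
  -- If tight arcs lead from the head `y` of a bad arc back to its tail `x`, they number a multiple
  -- of `m`, and the bad arc closes a circuit of length `1` modulo `m`.
  by_cases hreach : Relation.ReflTransGen R y x
  · obtain ⟨n, h, h0, hn, hR, hinj⟩ := exists_injOn_of_reflTransGen hreach
    have hdiff : ∀ i ≤ n, (m : ℤ) ∣ π (h 0) - π (h i) - i := by
      intro i hi
      induction i with
      | zero => simp
      | succ i ih =>
        have h1 := dvd_add (ih (by omega)) (hR i (by omega)).2.2.2
        have h2 : π (h 0) - π (h (i + 1)) - ((i + 1 : ℕ) : ℤ) =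
            π (h 0) - π (h i) - i + (π (h i) - π (h (i + 1)) - 1) := by push_cast; ring
        rwa [h2]
    have hdn : m ∣ n := by
      have h1 := dvd_add (hdiff n le_rfl) hdvd
      rw [h0, hn] at h1
      have h2 : π y - π x - n + (π x - π y) = -(n : ℤ) := by ring
      rw [h2, dvd_neg] at h1
      exact_mod_cast h1
    refine hno (n + 1) h ⟨by omega, ?_, ?_, ?_, ?_⟩ ?_
    · intro i hi
      rcases Nat.lt_or_ge i n with hin | hin
      · exact (hR i hin).1
      · rw [show i = n by omega, hn]
        exact hx
    · exact hinj.mono fun i hi => by simp only [Set.mem_Iio, Set.mem_Iic] at *; omega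
    · exact fun i hi => (hR i (by omega)).2.2.1
    · simpa [h0, hn] using hxy
    · have := (Nat.modEq_zero_iff_dvd.2 hdn).add_right 1
      simpa using this
  -- Otherwise lower `π` by one on the set reached from `y`. No tight arc leaves this set, so no
  -- weight grows, while the weight of the bad arc drops.
  · let π' : V → ℤ := fun u => if Relation.ReflTransGen R y u then π u - 1 else π u
    have hle : ∀ p ∈ Set.range g, ∀ q ∈ Set.range g, D.Adj p q → w π' p q ≤ w π p q := by
      intro p hp q hq hpq
      by_cases h1 : Relation.ReflTransGen R y p <;> by_cases h2 : Relation.ReflTransGen R y q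
      · simp [w, π', h1, h2]
      · have h3 : ¬ (m : ℤ) ∣ π p - π q - 1 := fun hd => h2 (h1.tail ⟨hp, hq, hpq, hd⟩)
        simp only [w, π', h1, h2, if_true, if_false]
        rw [show π p - 1 - π q - 1 = π p - π q - 1 - 1 by ring, sub_one_ediv_of_not_dvd hm' h3]
      · simp only [w, π', h1, h2, if_true, if_false]
        exact neg_le_neg (Int.ediv_le_ediv hm' (by linarith))
      · simp [w, π', h1, h2]
    have hlt : w π' x y < w π x y := by
      simp only [w, π', hreach, Relation.ReflTransGen.refl, if_true, if_false]
      refine neg_lt_neg (Int.ediv_lt_of_lt_mul hm' ?_)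
      rw [show π x - (π y - 1) - 1 = π x - π y by ring, Int.ediv_mul_cancel hdvd]
      linarith
    have hmem : ∀ z ∈ Set.range g, ∃ i < N, g i = z := by
      rintro _ ⟨i, rfl⟩
      exact ⟨i % N, Nat.mod_lt _ hN, Function.Periodic.map_mod_nat (f := g) hper i⟩
    obtain ⟨i, hi, rfl⟩ := hmem x hx
    obtain ⟨j, hj, rfl⟩ := hmem y hy
    have hterm : ∀ q : ℕ × ℕ, ∑ s ∈ Finset.range (q.1 + N - q.2),
        w π' (g (q.2 + s)) (g (q.2 + s + 1)) ≤ ∑ s ∈ Finset.range (q.1 + N - q.2),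
        w π (g (q.2 + s)) (g (q.2 + s + 1)) := fun q =>
      Finset.sum_le_sum fun s _ => hle _ ⟨_, rfl⟩ _ ⟨_, rfl⟩ (hg _)
    refine absurd (hmin π') (not_le.2 (Finset.sum_lt_sum (fun q hq => ?_) ⟨(i, j), ?_, ?_⟩))
    · simp only [P, Finset.mem_filter] at hq
      exact add_le_add (hle _ ⟨_, rfl⟩ _ ⟨_, rfl⟩ hq.2) (hterm q)
    · simp [P, hi, hj, hxy]
    · exact add_lt_add_of_lt_of_le hlt (hterm (i, j))

/-- `C` is a set of vertices that behaves like a shortest circuit of length at least `L + 2`: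
each of its vertices ends a long path inside `C`, the colouring `f` of `C` with `L + 1` colours is
proper outside `v`, and every large subset of `C \ {v}` contains the end of a long path that
avoids `v`. -/
structure IsHub (D : Digraph V) (L : ℕ) (C : Set V) (v : V) (f : V → Fin (L + 1)) : Prop where
  mem : v ∈ C
  path : ∀ c ∈ C, EndsPath D (L + 1) C c
  proper : ∀ x ∈ C, ∀ y ∈ C, x ≠ v → y ≠ v → D.Adj x y → f x ≠ f y
  avoid : ∀ W ⊆ C \ {v}, L + 1 ≤ W.ncard → ∃ c ∈ W, EndsPath D L (C \ {v}) c

theorem exists_hub {D : Digraph V} (hloop : ∀ x, ¬ D.Adj x x) {L : ℕ} (hL : 1 ≤ L) {S : Set V}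
    (hS : ∃ M, L + 2 ≤ M ∧ ∃ h, IsCircuit D S M h) :
    ∃ C ⊆ S, ∃ v f, IsHub D L C v f := by
  classical
  obtain ⟨hLN, h, hc⟩ := Nat.find_spec hS
  have hmin : ∀ M h, L + 2 ≤ M → IsCircuit D S M h → Nat.find hS ≤ M :=
    fun M h h1 h2 => Nat.find_min' hS ⟨h1, h, h2⟩
  generalize Nat.find hS = N at hLN hc hmin
  have hN : 0 < N := hc.pos
  let g : ℕ → V := fun n => h (n % N)
  have hper : ∀ n, g (n + N) = g n := fun n => by simp [g]
  have hg : ∀ n, D.Adj (g n) (g (n + 1)) := fun n => by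
    have h1 := Nat.mod_lt n hN
    by_cases h2 : n % N + 1 = N
    · have h3 : (n + 1) % N = 0 := by
        rw [Nat.add_mod, Nat.mod_eq_of_lt (show 1 < N by omega), h2, Nat.mod_self]
      simp only [g, h3, show n % N = N - 1 by omega]
      exact hc.close
    · have h3 : (n + 1) % N = n % N + 1 := by
        rw [Nat.add_mod, Nat.mod_eq_of_lt (show 1 < N by omega), Nat.mod_eq_of_lt (by omega)]
      simp only [g, h3]
      exact hc.adj _ (by omega)
  have ginj : ∀ a b, g a = g b → a ≡ b [MOD N] := fun a b hab =>
    hc.inj (Nat.mod_lt _ hN) (Nat.mod_lt _ hN) hab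
  have ginj' : ∀ a i j, i < N → j < N → g (a + i) = g (a + j) → i = j := fun a i j hi hj hij =>
    Nat.ModEq.eq_of_lt_of_lt (Nat.ModEq.add_left_cancel' a (ginj _ _ hij)) hi hj
  have gS : ∀ n, g n ∈ S := fun n => hc.mem _ (Nat.mod_lt _ hN)
  have hidx : ∀ x ∈ Set.range g, ∃ i < N, g i = x := by
    rintro _ ⟨i, rfl⟩
    exact ⟨i % N, Nat.mod_lt _ hN, by simp [g]⟩
  -- A chord from `g b` to `g a` closes a segment into a circuit with `b - a + 1` vertices, to which
  -- minimality of `N` applies.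
  have hchord : ∀ a b, a ≤ b → b - a < N → D.Adj (g b) (g a) → L + 1 ≤ b - a → N ≤ b - a + 1 := by
    intro a b hab hlt hadj hlen
    refine hmin (b - a + 1) (fun i => g (a + i)) (by omega)
      ⟨by omega, fun i _ => gS _, ?_, fun i _ => hg _, ?_⟩
    · intro i hi j hj hij
      simp only [Set.mem_Iio] at hi hj
      exact ginj' a i j (by omega) (by omega) hij
    · simpa [Nat.add_sub_cancel' hab] using hadj
  have hpath : ∀ a n (T : Set V), n < N → (∀ i ≤ n, g (a + i) ∈ T) →
      EndsPath D n T (g (a + n)) := by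
    intro a n T hn hT
    refine EndsPath.of_seq (fun i => g (a + i)) hT ?_ fun i _ => hg _
    intro i hi j hj hij
    simp only [Set.mem_Iic] at hi hj
    exact ginj' a i j (by omega) (by omega) hij
  have h0 : ∀ i, 0 < i → i < N → g i ≠ g 0 := fun i h1 h2 h3 => by
    have := ginj' 0 i 0 h2 hN (by simpa using h3)
    omega
  obtain ⟨f, hf⟩ : ∃ f : V → Fin (L + 1), ∀ x ∈ Set.range g, ∀ y ∈ Set.range g,
      x ≠ g 0 → y ≠ g 0 → D.Adj x y → f x ≠ f y := by
    -- A circuit of length `1` modulo `L + 1` is not a loop, so it has length at least `L + 2` and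
    -- hence exactly `N`. Thus `exists_potential` fails to apply only if `N ≡ 1`, and then positions
    -- modulo `L + 1` serve as colours.
    by_cases hmod : N ≡ 1 [MOD (L + 1)]
    · have hidx' : ∀ x, ∃ i, x ∈ Set.range g → i < N ∧ g i = x := fun x => by
        by_cases hx : x ∈ Set.range g
        · obtain ⟨i, hi⟩ := hidx x hx
          exact ⟨i, fun _ => hi⟩
        · exact ⟨0, fun h => absurd h hx⟩
      choose ι hι using hidx'
      refine ⟨fun x => Fin.ofNat (L + 1) (ι x), fun x hx y hy hxv hyv hxy hfe => ?_⟩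
      obtain ⟨hi, hix⟩ := hι x hx
      obtain ⟨hj, hjy⟩ := hι y hy
      have hfe' : ι x ≡ ι y [MOD (L + 1)] := by simpa [Fin.ext_iff, Nat.ModEq] using hfe
      generalize ι x = i at hi hix hfe'
      generalize ι y = j at hj hjy hfe'
      subst hix hjy
      have hi0 : i ≠ 0 := fun h => hxv (by rw [h])
      have hj0 : j ≠ 0 := fun h => hyv (by rw [h])
      rcases lt_trichotomy i j with hij | rfl | hij
      · obtain ⟨q, hq⟩ := (Nat.modEq_iff_dvd' hij.le).1 hfe'
        have hq1 : L + 1 ≤ j - i := by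
          rw [hq]
          rcases q with _ | q
          · omega
          · exact Nat.le_mul_of_pos_right _ (by omega)
        -- A forward chord shortcuts the circuit. Minimality leaves `N - (j - i) ≤ L`, so this
        -- number, being `1` modulo `L + 1`, equals `1`; that forces `i = 0`, the excluded vertex.
        have h1 := hchord j (i + N) (by omega) (by omega) (by rwa [hper])
        have h2 : N - (j - i) ≤ L := by omega
        have h3 : N - (j - i) ≡ 1 [MOD (L + 1)] := by
          have h4 : N - (j - i) + (L + 1) * q = N := by omega
          have h5 : N - (j - i) + (L + 1) * q ≡ N - (j - i) [MOD (L + 1)] := by simp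
          rw [h4] at h5
          exact h5.symm.trans hmod
        have := h3.eq_of_lt_of_lt (by omega) (by omega)
        omega
      · exact hloop _ hxy
      · obtain ⟨q, hq⟩ := (Nat.modEq_iff_dvd' hij.le).1 hfe'.symm
        have hq1 : L + 1 ≤ i - j := by
          rw [hq]
          rcases q with _ | q
          · omega
          · exact Nat.le_mul_of_pos_right _ (by omega)
        have h1 := hchord j i hij.le (by omega) hxy hq1
        omega
    · obtain ⟨π, hπ⟩ := exists_potential D (m := L + 1) (by omega) hN hper hg (by
        intro M k hk hM
        have hkS : IsCircuit D S M k := ⟨hk.pos, fun i hi => by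
          obtain ⟨n, hn⟩ := hk.mem i hi
          exact hn ▸ gS n, hk.inj, hk.adj, hk.close⟩
        have hM1 : M ≠ 1 := by
          rintro rfl
          exact hloop _ hk.close
        have hM0 := hk.pos
        have hML : L + 2 ≤ M := by
          by_contra! hlt
          rcases Nat.lt_or_ge M (L + 1) with h1 | h1
          · exact hM1 (hM.eq_of_lt_of_lt h1 (by omega))
          · rw [show M = L + 1 by omega] at hM
            have := hM.symm.trans (show L + 1 ≡ 0 [MOD (L + 1)] by simp [Nat.ModEq])
            have := this.eq_of_lt_of_lt (by omega) (by omega)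
            omega
        have h1 := hmin M k hML hkS
        have h2 : M ≤ N := by
          have hsub : k '' Set.Iio M ⊆ g '' Set.Iio N := by
            rintro _ ⟨i, hi, rfl⟩
            obtain ⟨j, hj, hjx⟩ := hidx _ (hk.mem i hi)
            exact ⟨j, hj, hjx⟩
          have h3 := Set.ncard_le_ncard hsub ((Set.finite_Iio N).image g)
          have h4 := Set.ncard_image_le (f := g) (Set.finite_Iio N)
          rw [hk.inj.ncard_image] at h3
          simpa [Set.ncard_eq_toFinset_card'] using h3.trans h4
        exact hmod (by rwa [show N = M by omega]))
      have hLpos : (0 : ℤ) < ((L + 1 : ℕ) : ℤ) := by positivity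
      refine ⟨fun x => ⟨(π x % ((L + 1 : ℕ) : ℤ)).toNat, ?_⟩, fun x hx y hy _ _ hxy hfe => ?_⟩
      · have h1 := Int.emod_nonneg (π x) hLpos.ne'
        have h2 := Int.emod_lt_of_pos (π x) hLpos
        omega
      · have h1 := Int.emod_nonneg (π x) hLpos.ne'
        have h2 := Int.emod_nonneg (π y) hLpos.ne'
        rw [Fin.mk.injEq] at hfe
        exact hπ x hx y hy hxy (Int.ModEq.dvd (show π y % _ = π x % _ by omega))
  refine ⟨Set.range g, Set.range_subset_iff.2 gS, g 0, f, ⟨0, rfl⟩, ?_, hf, ?_⟩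
  · rintro _ ⟨i, rfl⟩
    have := hpath (i + 1) (N - 1) (Set.range g) (by omega) fun i _ => ⟨_, rfl⟩
    rw [show i + 1 + (N - 1) = i + N by omega, hper] at this
    exact this.of_le (by omega)
  · intro W hW hcard
    by_contra! hcon
    -- For `i > L` the segment from `g (i - L)` to `g i` misses `g 0`, so only `L` vertices are
    -- exceptional.
    have hsub : W ⊆ g '' Set.Icc 1 L := by
      intro c hcW
      obtain ⟨i, hi, rfl⟩ := hidx c (hW hcW).1
      have hi0 : i ≠ 0 := fun h => (hW hcW).2 (by rw [h]; rfl)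
      refine ⟨i, ⟨by omega, ?_⟩, rfl⟩
      by_contra! hlt
      refine hcon _ hcW ?_
      have := hpath (i - L) L (Set.range g \ {g 0}) (by omega)
        fun t ht => ⟨⟨_, rfl⟩, h0 _ (by omega) (by omega)⟩
      rwa [Nat.sub_add_cancel hlt.le] at this
    have h1 := Set.ncard_le_ncard hsub ((Set.finite_Icc 1 L).image g)
    have h2 := Set.ncard_image_le (f := g) (Set.finite_Icc 1 L)
    have h3 : (Set.Icc 1 L).ncard = L := by simp [Set.ncard_eq_toFinset_card']
    omega

/-! ### Colouring the union of disjoint hubs and a forest -/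

/-- A family of disjoint hubs of `D`, and a final spanning out-forest of the remaining vertices
all of whose fundamental circuits have length at most `L + 1`. The hub `C` has the special vertex
`apex C` and the colouring `shade C`; the number `height C` is the least strict upper bound for the
levels of the in-neighbours of `apex C` in the forest. -/
structure HubForest (D : Digraph V) (K L : ℕ) where
  hubs : Set (Set V)
  apex : Set V → V
  shade : Set V → V → Fin (L + 1)
  par : V → V
  lev : V → ℕ
  height : Set V → ℕ
  le : K ≤ L
  free : BlockFree D K L
  isHub : ∀ C ∈ hubs, IsHub D L C (apex C) (shade C)
  eq_of_mem : ∀ C ∈ hubs, ∀ C' ∈ hubs, ∀ x ∈ C, x ∈ C' → C = C'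
  isForest : IsForest D (⋃₀ hubs)ᶜ par lev
  final : ∀ x ∈ (⋃₀ hubs)ᶜ, ∀ y ∈ (⋃₀ hubs)ᶜ, D.Adj x y → lev x < lev y ∨ y ∈ anc par lev x
  short : ∀ x ∈ (⋃₀ hubs)ᶜ, ∀ y ∈ anc par lev x, D.Adj x y → lev x ≤ lev y + L
  lt_height : ∀ C ∈ hubs, ∀ s ∈ (⋃₀ hubs)ᶜ, D.Adj s (apex C) → lev s < height C
  height_eq : ∀ C ∈ hubs, height C = 0 ∨
    ∃ s ∈ (⋃₀ hubs)ᶜ, D.Adj s (apex C) ∧ height C = lev s + 1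

namespace HubForest

/-! ### Arcs forbidden between hubs and forest -/

variable {D : Digraph V} {K L : ℕ} (F : HubForest D K L) {C C' : Set V} {c u x y z : V} {n : ℕ}

/-- The vertices of the forest. -/
def ground : Set V := (⋃₀ F.hubs)ᶜ

/-- The ancestors of `x` in the forest. -/
def up (x : V) : Set V := anc F.par F.lev x

/-- The ancestor of `x` on level `K`. -/
def root (x : V) : V := F.par^[F.lev x - K] x

theorem notMem_ground (hC : C ∈ F.hubs) (hc : c ∈ C) : c ∉ F.ground :=
  fun h => h ⟨C, hC, hc⟩

theorem disjoint_up (hC : C ∈ F.hubs) (hx : x ∈ F.ground) : Disjoint C (F.up x) :=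
  Set.disjoint_left.2 fun _ hc ha => F.notMem_ground hC hc (F.isForest.anc_mem hx ha)

theorem lev_le (hx : x ∈ F.ground) (hy : y ∈ F.up x) : F.lev y ≤ F.lev x :=
  F.isForest.lev_le hx hy

theorem lev_par (hx : x ∈ F.ground) (h0 : 0 < F.lev x) : F.lev (F.par x) + 1 = F.lev x :=
  (F.isForest x hx h0).2.2

theorem par_mem (hx : x ∈ F.ground) (h0 : 0 < F.lev x) : F.par x ∈ F.ground :=
  (F.isForest x hx h0).1

theorem par_adj (hx : x ∈ F.ground) (h0 : 0 < F.lev x) : D.Adj (F.par x) x :=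
  (F.isForest x hx h0).2.1

theorem notMem_up (hx : x ∈ F.ground) (h : F.lev x < F.lev y) : y ∉ F.up x :=
  fun hy => absurd (F.lev_le hx hy) (by omega)

theorem notMem_up_par (hx : x ∈ F.ground) (h0 : 0 < F.lev x) : x ∉ F.up (F.par x) :=
  F.notMem_up (F.par_mem hx h0) (by have := F.lev_par hx h0; omega)

theorem up_par_subset (hx : x ∈ F.ground) (h0 : 0 < F.lev x) : F.up (F.par x) ⊆ F.up x :=
  fun _ ha => F.isForest.anc_trans hx (parent_mem_anc h0) ha

theorem endsPath_up (hx : x ∈ F.ground) (hn : n ≤ F.lev x) :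
    EndsPath D n {a | a ∈ F.up x ∧ F.lev x - n ≤ F.lev a} x :=
  F.isForest.endsPath_of_le hx hn

theorem endsPath_up' (hx : x ∈ F.ground) (hn : n ≤ F.lev x) : EndsPath D n (F.up x) x :=
  (F.endsPath_up hx hn).mono fun _ ha => ha.1

theorem exists_pred (hC : C ∈ F.hubs) (hc : c ∈ C) :
    ∃ w, D.Adj w c ∧ EndsPath D L (C \ {c}) w :=
  ((F.isHub C hC).path c hc).2

theorem lev_lt_of_adj_hub (hC : C ∈ F.hubs) (hc : c ∈ C) (hx : x ∈ F.ground) (h : D.Adj x c) :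
    F.lev x < K := by
  by_contra! hK
  obtain ⟨w, hw, hp⟩ := F.exists_pred hC hc
  exact F.free h hw (F.endsPath_up' hx hK) hp
    ((F.disjoint_up hC hx).symm.mono_right Set.sdiff_subset)
    (fun ha => F.notMem_ground hC hc (F.isForest.anc_mem hx ha)) (fun ha => ha.2 rfl)

theorem lev_le_of_hub_adj (hC : C ∈ F.hubs) (hc : c ∈ C) (hy : y ∈ F.ground) (h : D.Adj c y) :
    F.lev y ≤ K := by
  by_contra! hK
  have h0 : 0 < F.lev y := by omega
  exact F.free (F.par_adj hy h0) h
    (F.endsPath_up' (F.par_mem hy h0) (by have := F.lev_par hy h0; omega))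
    (((F.isHub C hC).path c hc).of_succ) (F.disjoint_up hC (F.par_mem hy h0)).symm
    (F.notMem_up_par hy h0) (fun ha => F.notMem_ground hC ha hy)

theorem hub_eq_of_adj (hC : C ∈ F.hubs) (hx : x ∈ C) (hC' : C' ∈ F.hubs) (hy : y ∈ C')
    (h : D.Adj x y) : C = C' := by
  by_contra hne
  have hdis : ∀ a ∈ C, a ∉ C' := fun a ha ha' => hne (F.eq_of_mem C hC C' hC' a ha ha')
  obtain ⟨w, hw, hp⟩ := F.exists_pred hC' hy
  exact F.free h hw ((((F.isHub C hC).path x hx).of_succ).of_le F.le) hp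
    (Set.disjoint_left.2 fun a ha ha' => hdis a ha ha'.1) (fun ha => hdis y ha hy)
    (fun ha => ha.2 rfl)

/-- The gap leaves room for `L` arcs of the branch to `y` strictly above the level of `x`, hence
disjoint from the branch to `x`. -/
theorem not_adj_of_far (hx : x ∈ F.ground) (hy : y ∈ F.ground) (hK : K ≤ F.lev x)
    (hL : F.lev x + L + 2 ≤ F.lev y) : ¬ D.Adj x y := by
  intro h
  have h0 : 0 < F.lev y := by omega
  have h1 := F.lev_par hy h0
  refine F.free h (F.par_adj hy h0) (F.endsPath_up' hx hK)
    (F.endsPath_up (n := L) (F.par_mem hy h0) (by omega)) (Set.disjoint_left.2 fun a ha ha' => ?_)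
    (F.notMem_up hx (by omega)) fun ha => F.notMem_up_par hy h0 ha.1
  have h2 := F.lev_le hx ha
  have h3 := ha'.2
  omega

theorem height_le (hC : C ∈ F.hubs) : F.height C ≤ K := by
  rcases F.height_eq C hC with h | ⟨s, hs, hadj, h⟩
  · omega
  · have := F.lev_lt_of_adj_hub hC (F.isHub C hC).mem hs hadj
    omega

/-! ### Raised vertices -/

/-- The vertices reached from the out-neighbours of `apex C` on level `height C` by arcs that go
up by exactly one level. -/
inductive Raised (C : Set V) : V → Prop
  | base {u : V} : u ∈ F.ground → D.Adj (F.apex C) u → F.lev u = F.height C → Raised C u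
  | step {u w : V} : Raised C u → D.Adj u w → w ∈ F.ground → F.lev w = F.lev u + 1 → Raised C w

variable {F}

theorem Raised.mem (h : F.Raised C u) : u ∈ F.ground := by
  cases h <;> assumption

theorem Raised.height_le_lev (h : F.Raised C u) : F.height C ≤ F.lev u := by
  induction h with
  | base _ _ h => exact h.ge
  | step _ _ _ h ih => omega

/-- Go round the hub to the apex and on through raised vertices, dropping an initial arc for each
arc added. -/
theorem Raised.endsPath (hC : C ∈ F.hubs) (h : F.Raised C u) :
    EndsPath D (L + 1) (C ∪ {w | F.Raised C w ∧ F.lev w ≤ F.lev u}) u := by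
  induction h with
  | @base u hu hadj hlev =>
    refine ((((F.isHub C hC).path _ (F.isHub C hC).mem).snoc hadj
      fun h => F.notMem_ground hC h hu).of_succ).mono ?_
    rintro a (rfl | ha)
    · exact Or.inr ⟨.base hu hadj hlev, le_rfl⟩
    · exact Or.inl ha
  | @step u w hu hadj hw hlev ih =>
    refine ((ih.snoc hadj ?_).of_succ).mono ?_
    · rintro (h | h)
      · exact F.notMem_ground hC h hw
      · have := h.2
        omega
    · rintro a (rfl | ha | ha)
      · exact Or.inr ⟨.step hu hadj hw hlev, le_rfl⟩
      · exact Or.inl ha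
      · exact Or.inr ⟨ha.1, by have := ha.2; omega⟩

/-- Unlike in `Raised.endsPath`, the hub is met only at its apex, entered from a forest branch of
level `height C - 1`, or used as the start if `height C = 0`. The rest of the hub stays free for a
second path. -/
theorem Raised.endsPath_apex (hC : C ∈ F.hubs) (h : F.Raised C u) :
    EndsPath D (F.lev u + 1) (insert (F.apex C) {w | w ∈ F.ground ∧ F.lev w ≤ F.lev u}) u := by
  have hv := (F.isHub C hC).mem
  have hvG := F.notMem_ground hC hv
  induction h with
  | @base u hu hadj hlev =>
    have key : EndsPath D (F.lev u)
        (insert (F.apex C) {w | w ∈ F.ground ∧ F.lev w < F.lev u}) (F.apex C) := by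
      rw [hlev]
      rcases F.height_eq C hC with h | ⟨s, hs, hsv, h⟩
      · rw [h]
        exact Set.mem_insert _ _
      · rw [h]
        refine ((F.endsPath_up' hs le_rfl).snoc hsv fun ha =>
          hvG (F.isForest.anc_mem hs ha)).mono (Set.insert_subset_insert fun a ha => ?_)
        exact ⟨F.isForest.anc_mem hs ha, Nat.lt_succ_of_le (F.lev_le hs ha)⟩
    refine (key.snoc hadj ?_).mono ?_
    · rintro (h | h)
      · exact hvG (h ▸ hu)
      · exact lt_irrefl _ h.2
    · rintro a (rfl | rfl | ha)
      · exact Or.inr ⟨hu, le_rfl⟩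
      · exact Or.inl rfl
      · exact Or.inr ⟨ha.1, ha.2.le⟩
  | @step u w hu hadj hw hlev ih =>
    rw [hlev]
    refine (ih.snoc hadj ?_).mono ?_
    · rintro (h | h)
      · exact hvG (h ▸ hw)
      · have := h.2
        omega
    · rintro a (rfl | rfl | ha)
      · exact Or.inr ⟨hw, hlev.le⟩
      · exact Or.inl rfl
      · exact Or.inr ⟨ha.1, by have := ha.2; omega⟩

theorem Raised.of_mem_up (h : F.Raised C u) (hx : x ∈ F.ground) (hu : u ∈ F.up x) :
    F.Raised C x := by
  obtain ⟨t, ht, htu⟩ := hu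
  induction t generalizing x with
  | zero =>
    obtain rfl : x = u := htu
    exact h
  | succ t ih =>
    have h0 : 0 < F.lev x := by omega
    have h1 := F.lev_par hx h0
    exact .step (ih (F.par_mem hx h0) (by omega) htu) (F.par_adj hx h0) hx h1.symm

theorem Raised.not_adj_of_far (hC : C ∈ F.hubs) (h : F.Raised C u) (hy : y ∈ F.ground)
    (hK : F.lev u + K + 2 ≤ F.lev y) : ¬ D.Adj u y := by
  intro hadj
  have h0 : 0 < F.lev y := by omega
  have h1 := F.lev_par hy h0
  refine F.free (F.par_adj hy h0) hadj
    (F.endsPath_up (n := K) (F.par_mem hy h0) (by omega)) (h.endsPath hC).of_succ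
    (Set.disjoint_left.2 ?_) (fun ha => F.notMem_up_par hy h0 ha.1) ?_
  · rintro a ha (ha' | ha')
    · exact F.notMem_ground hC ha' (F.isForest.anc_mem (F.par_mem hy h0) ha.1)
    · have h2 := ha.2
      have h3 := ha'.2
      omega
  · rintro (ha | ha)
    · exact F.notMem_ground hC ha hy
    · have := ha.2
      omega

theorem Raised.disjoint_hub (hC : C ∈ F.hubs) (hC' : C' ∈ F.hubs) (hne : C ≠ C') (n : ℕ) :
    Disjoint (C ∪ {w | F.Raised C w ∧ F.lev w ≤ n}) C' := by
  refine Set.disjoint_left.2 ?_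
  rintro a (ha | ha) ha'
  · exact hne (F.eq_of_mem C hC C' hC' a ha ha')
  · exact F.notMem_ground hC' ha' ha.1.mem

theorem Raised.eq_of_adj_hub (hC : C ∈ F.hubs) (h : F.Raised C u) (hC' : C' ∈ F.hubs)
    (hc : c ∈ C') (hadj : D.Adj u c) : C = C' := by
  by_contra hne
  obtain ⟨w, hw, hp⟩ := F.exists_pred hC' hc
  have hdis := Raised.disjoint_hub hC hC' hne (F.lev u)
  exact F.free hadj hw ((h.endsPath hC).of_le (by have := F.le; omega)) hp
    (hdis.mono_right Set.sdiff_subset) (fun ha => Set.disjoint_left.1 hdis ha hc)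
    (fun ha => ha.2 rfl)

theorem Raised.eq_of_hub_adj (hC : C ∈ F.hubs) (h : F.Raised C u) (hC' : C' ∈ F.hubs)
    (hc : c ∈ C') (hadj : D.Adj c u) : C = C' := by
  by_contra hne
  obtain ⟨-, w, hw, hp⟩ := h.endsPath hC
  have hdis := Raised.disjoint_hub hC hC' hne (F.lev u)
  exact F.free hw hadj (hp.of_le F.le) ((F.isHub C' hC').path c hc).of_succ
    (hdis.mono_left Set.sdiff_subset) (fun ha => ha.2 rfl)
    (fun ha => F.notMem_ground hC' ha h.mem)

/-! ### Ancestors on level `K` and arcs between different branches -/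

variable (F)

theorem root_mem_up (x : V) : F.root x ∈ F.up x :=
  ⟨F.lev x - K, Nat.sub_le _ _, rfl⟩

theorem root_mem (hx : x ∈ F.ground) : F.root x ∈ F.ground :=
  F.isForest.anc_mem hx (F.root_mem_up x)

theorem lev_root (hx : x ∈ F.ground) (hK : K ≤ F.lev x) : F.lev (F.root x) = K := by
  have := (F.isForest.iterate hx (Nat.sub_le (F.lev x) K)).2
  unfold root
  omega

theorem root_eq_self (hK : F.lev x = K) : F.root x = x := by
  simp [root, hK]

theorem root_eq_of_mem_up (hx : x ∈ F.ground) (hy : y ∈ F.up x) (hK : K ≤ F.lev y) :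
    F.root y = F.root x := by
  have hyG := F.isForest.anc_mem hx hy
  refine F.isForest.eq_of_lev_eq hx (F.root_mem_up x)
    (F.isForest.anc_trans hx hy (F.root_mem_up y)) ?_
  rw [F.lev_root hyG hK, F.lev_root hx (hK.trans (F.lev_le hx hy))]

theorem mem_up_root (hx : x ∈ F.ground) (hy : y ∈ F.up x) (hK : F.lev y ≤ K)
    (hKx : K ≤ F.lev x) : y ∈ F.up (F.root x) :=
  F.isForest.anc_of_le hx (F.root_mem_up x) hy (by rwa [F.lev_root hx hKx])

/-- The path continues along tree arcs, losing an initial arc for each one gained; the level bound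
on `S` keeps the new vertices new. -/
theorem endsPath_of_mem_up {S : Set V} (hx : x ∈ F.ground) (hz : z ∈ F.up x)
    (hS : ∀ a ∈ S, a ∈ F.ground → F.lev a ≤ F.lev z) (h : EndsPath D n S z) :
    EndsPath D n (S ∪ {a | a ∈ F.up x ∧ F.lev z < F.lev a}) x := by
  obtain ⟨t, ht, htz⟩ := hz
  induction t generalizing x with
  | zero =>
    obtain rfl : x = z := htz
    exact h.mono Set.subset_union_left
  | succ t ih =>
    have h0 : 0 < F.lev x := by omega
    have h1 := F.lev_par hx h0
    have hp := ih (F.par_mem hx h0) (by omega) htz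
    have hzlt : F.lev z < F.lev x := by
      have := (F.isForest.iterate hx ht).2
      rw [htz] at this
      omega
    refine ((hp.snoc (F.par_adj hx h0) ?_).of_succ).mono ?_
    · rintro (ha | ha)
      · have := hS x ha hx
        omega
      · exact F.notMem_up_par hx h0 ha.1
    · rintro a (rfl | ha | ha)
      · exact Or.inr ⟨mem_anc_self _ _ _, hzlt⟩
      · exact Or.inl ha
      · exact Or.inr ⟨F.up_par_subset hx h0 ha.1, ha.2⟩

theorem root_ne_of_mem (hx : x ∈ F.ground) (hy : y ∈ F.ground) (hne : F.root x ≠ F.root y)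
    {a : V} (hax : a ∈ F.up x) (hay : a ∈ F.up y) : F.lev a < K := by
  by_contra! hK
  exact hne ((F.root_eq_of_mem_up hx hax hK).symm.trans (F.root_eq_of_mem_up hy hay hK))

/-- The path with `L` arcs is pushed from `root x` to `x`, and the one with `K` arcs runs to the
parent of `y`. Different roots make the branches disjoint from level `K` on. -/
theorem not_adj_of_endsPath_root_left {S : Set V} (hx : x ∈ F.ground) (hy : y ∈ F.ground)
    (hK : K ≤ F.lev x) (hxy : F.lev x < F.lev y) (hne : F.root x ≠ F.root y)
    (hS : ∀ a ∈ S, a ∈ F.ground → F.lev a ≤ K) (hdis : Disjoint S (F.up y))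
    (h : EndsPath D L S (F.root x)) : ¬ D.Adj x y := by
  intro hadj
  have h0 : 0 < F.lev y := by omega
  have h1 := F.lev_par hy h0
  have hz := F.lev_root hx hK
  refine F.free (F.par_adj hy h0) hadj (F.endsPath_up' (F.par_mem hy h0) (by omega))
    (F.endsPath_of_mem_up hx (F.root_mem_up x) (by rwa [hz]) h)
    (Set.disjoint_left.2 ?_) (F.notMem_up_par hy h0) ?_
  · rintro a ha (ha' | ha')
    · exact Set.disjoint_left.1 hdis ha' (F.up_par_subset hy h0 ha)
    · have h2 := F.root_ne_of_mem hx hy hne ha'.1 (F.up_par_subset hy h0 ha)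
      have h3 := ha'.2
      omega
  · rintro (ha | ha)
    · exact Set.disjoint_left.1 hdis ha (mem_anc_self _ _ _)
    · exact F.notMem_up hx hxy ha.1

theorem not_adj_of_endsPath_root_right {S : Set V} (hx : x ∈ F.ground) (hy : y ∈ F.ground)
    (hK : K ≤ F.lev x) (hxy : F.lev x < F.lev y) (hne : F.root x ≠ F.root y)
    (hS : ∀ a ∈ S, a ∈ F.ground → F.lev a ≤ K) (hdis : Disjoint S (F.up x))
    (h : EndsPath D L S (F.root y)) : ¬ D.Adj x y := by
  intro hadj
  have h0 : 0 < F.lev y := by omega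
  have h1 := F.lev_par hy h0
  have hpy := F.par_mem hy h0
  have hz := F.lev_root hy (by omega)
  have hroot : F.root (F.par y) = F.root y :=
    F.root_eq_of_mem_up hy (parent_mem_anc h0) (by omega)
  have hzp : F.root y ∈ F.up (F.par y) := hroot ▸ F.root_mem_up (F.par y)
  refine F.free hadj (F.par_adj hy h0) (F.endsPath_up' hx hK)
    (F.endsPath_of_mem_up hpy hzp (by rwa [hz]) h)
    (Set.disjoint_left.2 ?_) (F.notMem_up hx hxy) ?_
  · rintro a ha (ha' | ha')
    · exact Set.disjoint_left.1 hdis ha' ha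
    · have h2 := F.root_ne_of_mem hx hy hne ha (F.up_par_subset hy h0 ha'.1)
      have h3 := ha'.2
      omega
  · rintro (ha | ha)
    · have := hS y ha hy
      omega
    · exact F.notMem_up_par hy h0 ha.1

/-- `z` is an out-neighbour of some hub. -/
def HubAdj (z : V) : Prop := ∃ C ∈ F.hubs, ∃ c ∈ C, D.Adj c z

/-- `z` is raised with respect to some hub. -/
def IsRaised (z : V) : Prop := ∃ C ∈ F.hubs, F.Raised C z

theorem root_not_hubAdj (hx : x ∈ F.ground) (hy : y ∈ F.ground) (hK : K ≤ F.lev x)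
    (hxy : F.lev x < F.lev y) (hne : F.root x ≠ F.root y) (hadj : D.Adj x y) :
    ¬ F.HubAdj (F.root x) ∧ ¬ F.HubAdj (F.root y) := by
  have hKy : K ≤ F.lev y := by omega
  have hpath : ∀ {w}, w ∈ F.ground → ∀ C ∈ F.hubs, ∀ c ∈ C, D.Adj c (F.root w) →
      EndsPath D L (insert (F.root w) C) (F.root w) := fun {w} hw C hC c hc h =>
    (((F.isHub C hC).path c hc).snoc h fun h' =>
      F.notMem_ground hC h' (F.root_mem hw)).of_le (by omega)
  have hlev : ∀ {w}, w ∈ F.ground → K ≤ F.lev w → ∀ C ∈ F.hubs,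
      ∀ a ∈ insert (F.root w) C, a ∈ F.ground → F.lev a ≤ K := by
    rintro w hw hKw C hC a (rfl | ha) haG
    · exact (F.lev_root hw hKw).le
    · exact absurd haG (F.notMem_ground hC ha)
  have hdis : ∀ {w w'}, w ∈ F.ground → w' ∈ F.ground → K ≤ F.lev w → F.root w ≠ F.root w' →
      ∀ C ∈ F.hubs, Disjoint (insert (F.root w) C) (F.up w') := by
    refine fun {w w'} hw hw' hKw hne C hC => Set.disjoint_insert_left.2
      ⟨fun ha => ?_, F.disjoint_up hC hw'⟩
    have := F.root_ne_of_mem hw hw' hne (F.root_mem_up w) ha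
    rw [F.lev_root hw hKw] at this
    exact lt_irrefl _ this
  constructor
  · rintro ⟨C, hC, c, hc, h⟩
    exact F.not_adj_of_endsPath_root_left hx hy hK hxy hne (hlev hx hK C hC)
      (hdis hx hy hK hne C hC) (hpath hx C hC c hc h) hadj
  · rintro ⟨C, hC, c, hc, h⟩
    exact F.not_adj_of_endsPath_root_right hx hy hK hxy hne (hlev hy hKy C hC)
      (hdis hy hx hKy hne.symm C hC) (hpath hy C hC c hc h) hadj

/-- Raising passes to descendants, so a branch with unraised root contains no raised vertex of level
at most `K`. It is therefore disjoint from a path witnessing that the other root is raised. -/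
theorem root_isRaised_iff (hx : x ∈ F.ground) (hy : y ∈ F.ground) (hK : K ≤ F.lev x)
    (hxy : F.lev x < F.lev y) (hne : F.root x ≠ F.root y) (hadj : D.Adj x y) :
    F.IsRaised (F.root x) ↔ F.IsRaised (F.root y) := by
  have hKy : K ≤ F.lev y := by omega
  have hlev : ∀ C ∈ F.hubs, ∀ a ∈ C ∪ {w | F.Raised C w ∧ F.lev w ≤ K}, a ∈ F.ground →
      F.lev a ≤ K := by
    rintro C hC a (ha | ha) haG
    · exact absurd haG (F.notMem_ground hC ha)
    · exact ha.2
  have hdis : ∀ {w}, w ∈ F.ground → K ≤ F.lev w → ¬ F.IsRaised (F.root w) → ∀ C ∈ F.hubs,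
      Disjoint (C ∪ {w | F.Raised C w ∧ F.lev w ≤ K}) (F.up w) := by
    refine fun {w} hw hKw hr C hC => Set.disjoint_union_left.2
      ⟨F.disjoint_up hC hw, Set.disjoint_left.2 fun a ha haw => hr ⟨C, hC, ?_⟩⟩
    exact ha.1.of_mem_up (F.root_mem hw) (F.mem_up_root hw haw ha.2 hKw)
  constructor
  · rintro ⟨C, hC, h⟩
    by_contra hr
    have hp := h.endsPath hC
    rw [F.lev_root hx hK] at hp
    exact F.not_adj_of_endsPath_root_left hx hy hK hxy hne (hlev C hC) (hdis hy hKy hr C hC)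
      hp.of_succ hadj
  · rintro ⟨C, hC, h⟩
    by_contra hr
    have hp := h.endsPath hC
    rw [F.lev_root hy hKy] at hp
    exact F.not_adj_of_endsPath_root_right hx hy hK hxy hne (hlev C hC) (hdis hx hK hr C hC)
      hp.of_succ hadj

/-- If all `L + 1` shades occurred, `avoid` would give an in-neighbour in the hub ending a path with
`L` arcs off the apex, and `Raised.endsPath_apex` supplies the disjoint second path. -/
theorem exists_free_shade [Finite V] (z : V) (hK : F.lev z = K) (hr : F.IsRaised z) :
    ∃ k : Fin (L + 1), ∀ C ∈ F.hubs, ∀ c ∈ C, c ≠ F.apex C → D.Adj c z → F.shade C c ≠ k := by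
  classical
  obtain ⟨C, hC, h⟩ := hr
  by_contra! hcon
  choose C' hC' c hc hne hadj hk using hcon
  have hCC : ∀ k, C' k = C := fun k => (h.eq_of_hub_adj hC (hC' k) (hc k) (hadj k)).symm
  simp only [hCC] at hc hne hk
  have hinj : Function.Injective c := fun i j hij => by rw [← hk i, ← hk j, hij]
  obtain ⟨d, ⟨i, rfl⟩, hp⟩ := (F.isHub C hC).avoid (Set.range c)
    (Set.range_subset_iff.2 fun k => ⟨hc k, hne k⟩) (by
      rw [← Set.image_univ, hinj.injOn.ncard_image]
      simp)
  have hq := h.endsPath_apex hC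
  rw [hK] at hq
  obtain ⟨-, w, hw, hq⟩ := hq
  refine F.free hw (hadj i) hq hp (Set.disjoint_left.2 ?_) (fun ha => ha.2 rfl)
    (fun ha => F.notMem_ground hC ha.1 h.mem)
  rintro a ⟨rfl | ha, -⟩ ha'
  · exact ha'.2 rfl
  · exact F.notMem_ground hC ha'.1 ha.1

end HubForest

/-! ### The colouring -/

theorem swap_mul_swap_zero {n k : ℕ} :
    (Equiv.swap k n * Equiv.swap 0 n) 0 = k := by
  simp

theorem eq_of_swap_mul_swap_eq_zero {n k j : ℕ} (hk : k ≠ 0) (hn : n ≠ 0)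
    (h : (Equiv.swap k n * Equiv.swap 0 n) j = 0) : j = n := by
  have h1 : (Equiv.swap k n * Equiv.swap 0 n) n = 0 := by
    simp [Equiv.swap_apply_of_ne_of_ne hk.symm hn.symm]
  exact (Equiv.injective _) (h.trans h1.symm)

theorem swap_apply_le {a b n j : ℕ} (ha : a ≤ n) (hb : b ≤ n) (hj : j ≤ n) :
    Equiv.swap a b j ≤ n := by
  rw [Equiv.swap_apply_def]
  split_ifs <;> assumption

theorem HubForest.exists_coloring [Finite V] {D : Digraph V} {K L : ℕ} (F : HubForest D K L)
    (hloop : ∀ x, ¬ D.Adj x x) :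
    ∃ col : V → ℕ, (∀ x, col x < K + L + 2) ∧ ∀ x y, D.Adj x y → col x ≠ col y := by
  classical
  have hKL := F.le
  -- For a raised `z` on level `K` with an in-neighbour in a hub, `κ z - 1` is a free shade. The
  -- default `1` makes the permutations of two branches joined by an arc coincide.
  obtain ⟨κ, hκ0, hκL, hκ1, hκ⟩ : ∃ κ : V → ℕ, (∀ z, κ z ≠ 0) ∧ (∀ z, κ z ≤ L + 1) ∧
      (∀ z, ¬ F.HubAdj z → κ z = 1) ∧ ∀ z, F.lev z = K → F.IsRaised z →
        ∀ C ∈ F.hubs, ∀ c ∈ C, c ≠ F.apex C → D.Adj c z → (F.shade C c).val + 1 ≠ κ z := by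
    have : ∀ z, ∃ k : ℕ, k ≠ 0 ∧ k ≤ L + 1 ∧ (¬ F.HubAdj z → k = 1) ∧
        (F.lev z = K → F.IsRaised z → ∀ C ∈ F.hubs, ∀ c ∈ C, c ≠ F.apex C → D.Adj c z →
          (F.shade C c).val + 1 ≠ k) := by
      intro z
      by_cases h : F.HubAdj z ∧ F.lev z = K ∧ F.IsRaised z
      · obtain ⟨k, hk⟩ := F.exists_free_shade z h.2.1 h.2.2
        refine ⟨k.val + 1, by omega, by omega, fun h' => absurd h.1 h',
          fun _ _ C hC c hc hne hadj he => hk C hC c hc hne hadj (Fin.ext (by omega))⟩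
      · exact ⟨1, by omega, by omega, fun _ => rfl, fun hK hr C hC c hc _ hadj =>
          absurd ⟨⟨C, hC, c, hc, hadj⟩, hK, hr⟩ h⟩
    choose κ h1 h2 h3 h4 using this
    exact ⟨κ, h1, h2, h3, h4⟩
  have hhub : ∀ x, ∃ C, x ∉ F.ground → C ∈ F.hubs ∧ x ∈ C := fun x => by
    by_cases h : x ∈ F.ground
    · exact ⟨∅, fun h' => absurd h h'⟩
    · obtain ⟨C, hC⟩ := not_not.1 h
      exact ⟨C, fun _ => hC⟩
  choose hb hhb using hhub
  have hbeq : ∀ {C x}, C ∈ F.hubs → x ∈ C → hb x = C := fun {C x} hC hx =>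
    have h := hhb x (F.notMem_ground hC hx)
    F.eq_of_mem _ h.1 _ hC x h.2 hx
  -- It sends `0` to `κ` and `L + 1` to `0`. Thus colour `K`, now needed by raised vertices of level
  -- `K - 1`, reappears only at residue `L + 1`.
  let σ : V → Equiv.Perm ℕ := fun x => if F.IsRaised (F.root x) then
    Equiv.swap (κ (F.root x)) (L + 1) * Equiv.swap 0 (L + 1) else 1
  have hσle : ∀ x j, j ≤ L + 1 → σ x j ≤ L + 1 := fun x j hj => by
    simp only [σ]
    split_ifs
    · exact swap_apply_le (hκL _) le_rfl (swap_apply_le (Nat.zero_le _) le_rfl hj)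
    · exact hj
  let res : V → ℕ := fun x => (F.lev x - K) % (L + 2)
  have hres : ∀ x, res x ≤ L + 1 := fun x => Nat.lt_succ_iff.1 (Nat.mod_lt _ (by omega))
  let col : V → ℕ := fun x =>
    if x ∈ F.ground then
      if F.lev x < K then if F.IsRaised x then F.lev x + 1 else F.lev x
      else K + σ x (res x)
    else if x = F.apex (hb x) then F.height (hb x) else K + 1 + (F.shade (hb x) x).val
  have col_apex : ∀ C ∈ F.hubs, col (F.apex C) = F.height C := fun C hC => by
    have hm := (F.isHub C hC).mem
    simp only [col, F.notMem_ground hC hm, hbeq hC hm, if_true, if_false]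
  have col_hub : ∀ C ∈ F.hubs, ∀ c ∈ C, c ≠ F.apex C → col c = K + 1 + (F.shade C c).val :=
    fun C hC c hc hne => by
      simp only [col, F.notMem_ground hC hc, hbeq hC hc, hne, if_false]
  have col_low : ∀ x ∈ F.ground, F.lev x < K →
      col x = if F.IsRaised x then F.lev x + 1 else F.lev x := fun x hx hK => by
    simp only [col, hx, hK, if_true]
  have col_high : ∀ x ∈ F.ground, K ≤ F.lev x → col x = K + σ x (res x) := fun x hx hK => by
    simp only [col, hx, not_lt.2 hK, if_true, if_false]
  have col_low_le : ∀ x ∈ F.ground, F.lev x < K → col x ≤ K := fun x hx hK => by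
    rw [col_low x hx hK]
    split_ifs <;> omega
  have col_mid : ∀ x ∈ F.ground, F.lev x = K →
      col x = if F.IsRaised x then K + κ x else K := fun x hx hK => by
    rw [col_high x hx hK.ge]
    simp only [σ, F.root_eq_self hK, res, hK, Nat.sub_self, Nat.zero_mod]
    split_ifs
    · rw [swap_mul_swap_zero]
    · simp
  have col_ne_height : ∀ C ∈ F.hubs, ∀ x ∈ F.ground, F.lev x ≤ K →
      (∀ C' ∈ F.hubs, F.Raised C' x → C' = C) → (F.lev x = F.height C → F.Raised C x) →
      col x ≠ F.height C := by
    intro C hC x hx hK huniq hr he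
    have hh := F.height_le hC
    rcases hK.lt_or_eq with hK | hK
    · rw [col_low x hx hK] at he
      split_ifs at he with h
      · obtain ⟨C', hC', h⟩ := h
        have := (huniq C' hC' h ▸ h).height_le_lev
        omega
      · exact h ⟨C, hC, hr he⟩
    · rw [col_mid x hx hK] at he
      split_ifs at he with h
      · have := hκ0 x
        omega
      · exact h ⟨C, hC, hr (by omega)⟩
  have not_low_high : ∀ x ∈ F.ground, ∀ y ∈ F.ground, F.lev x < K → K ≤ F.lev y →
      D.Adj x y → col x ≠ col y := by
    intro x hx y hy hxK hyK hadj he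
    rw [col_low x hx hxK, col_high y hy hyK] at he
    split_ifs at he with hr
    · obtain ⟨C, hC, hr⟩ := hr
      have hfar : F.lev y < F.lev x + K + 2 := by
        by_contra! h
        exact hr.not_adj_of_far hC hy h hadj
      have hσ0 : σ y (res y) = 0 := by omega
      simp only [σ] at hσ0
      split_ifs at hσ0 with hry
      -- Residue `L + 1` means level at least `K + L + 1`, too far from level `K - 1` because `K ≤
      -- L`.
      · have h1 := eq_of_swap_mul_swap_eq_zero (hκ0 _) (by omega) hσ0
        have h2 := Nat.mod_le (F.lev y - K) (L + 2)
        simp only [res] at h1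
        omega
      · have h1 : (F.lev y - K) % (L + 2) = 0 := hσ0
        rw [Nat.mod_eq_of_lt (by omega)] at h1
        have hyK' : F.lev y = K := by omega
        refine hry ⟨C, hC, ?_⟩
        rw [F.root_eq_self hyK']
        exact hr.step hadj hy (by omega)
    · omega
  have same_res : ∀ x ∈ F.ground, ∀ y ∈ F.ground, K ≤ F.lev x → K ≤ F.lev y → D.Adj x y →
      res x ≠ res y := by
    intro x hx y hy hxK hyK hadj he
    have hmod : F.lev x - K ≡ F.lev y - K [MOD (L + 2)] := he
    rcases F.final x hx y hy hadj with hlt | hup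
    · obtain ⟨q, hq⟩ := (Nat.modEq_iff_dvd' (by omega)).1 hmod
      rcases q with _ | q
      · omega
      · have := Nat.le_mul_of_pos_right (L + 2) q.add_one_pos
        exact F.not_adj_of_far hx hy hxK (by omega) hadj
    · have hle := F.lev_le hx hup
      have hsh := F.short x hx y hup hadj
      obtain ⟨q, hq⟩ := (Nat.modEq_iff_dvd' (by omega)).1 hmod.symm
      rcases q with _ | q
      · have : x = y := F.isForest.eq_of_lev_eq hx hup (mem_anc_self _ _ _) (by omega)
        exact hloop x (this ▸ hadj)
      · have := Nat.le_mul_of_pos_right (L + 2) q.add_one_pos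
        omega
  refine ⟨col, fun x => ?_, fun x y hadj => ?_⟩
  · by_cases hx : x ∈ F.ground
    · rcases lt_or_ge (F.lev x) K with h | h
      · have := col_low_le x hx h
        omega
      · rw [col_high x hx h]
        have := hσle x _ (hres x)
        omega
    · obtain ⟨hC, hxC⟩ := hhb x hx
      by_cases hv : x = F.apex (hb x)
      · have h1 := col_apex _ hC
        have h2 := F.height_le hC
        rw [← hv] at h1
        omega
      · rw [col_hub _ hC x hxC hv]
        omega
  · by_cases hx : x ∈ F.ground <;> by_cases hy : y ∈ F.ground
    · rcases lt_or_ge (F.lev x) K with hxK | hxK <;> rcases lt_or_ge (F.lev y) K with hyK | hyK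
      · rw [col_low x hx hxK, col_low y hy hyK]
        rcases F.final x hx y hy hadj with hlt | hup
        · split_ifs with h1 h2 h2
          · omega
          · intro he
            obtain ⟨C, hC, h1⟩ := h1
            exact h2 ⟨C, hC, h1.step hadj hy (by omega)⟩
          · omega
          · omega
        · have hle := F.lev_le hx hup
          have hne : F.lev x ≠ F.lev y := fun he => by
            have : x = y := F.isForest.eq_of_lev_eq hx hup (mem_anc_self _ _ _) he
            exact hloop x (this ▸ hadj)
          split_ifs with h1 h2 h2
          · omega
          · omega
          · obtain ⟨C, hC, h2⟩ := h2
            exact absurd ⟨C, hC, h2.of_mem_up hx hup⟩ h1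
          · omega
      · exact not_low_high x hx y hy hxK hyK hadj
      · have hup := (F.final x hx y hy hadj).resolve_left (by omega)
        have hsh := F.short x hx y hup hadj
        intro he
        rw [col_low y hy hyK, col_high x hx hxK] at he
        split_ifs at he with hr
        · obtain ⟨C, hC, hr⟩ := hr
          have hrx : F.IsRaised (F.root x) :=
            ⟨C, hC, hr.of_mem_up (F.root_mem hx) (F.mem_up_root hx hup hyK.le hxK)⟩
          have hσ0 : σ x (res x) = 0 := by omega
          simp only [σ, hrx, if_true] at hσ0
          have h1 := eq_of_swap_mul_swap_eq_zero (hκ0 _) (by omega) hσ0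
          have h2 := Nat.mod_le (F.lev x - K) (L + 2)
          simp only [res] at h1
          omega
        · omega
      · rw [col_high x hx hxK, col_high y hy hyK]
        have hσ : σ x = σ y := by
          by_cases hroot : F.root x = F.root y
          · simp only [σ, hroot]
          · have hlt : F.lev x < F.lev y := (F.final x hx y hy hadj).resolve_right fun hup =>
              hroot (F.root_eq_of_mem_up hx hup hyK).symm
            have h1 := F.root_not_hubAdj hx hy hxK hlt hroot hadj
            have h2 := F.root_isRaised_iff hx hy hxK hlt hroot hadj
            simp only [σ, h2, hκ1 _ h1.1, hκ1 _ h1.2]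
        rw [hσ]
        intro he
        exact same_res x hx y hy hxK hyK hadj ((σ y).injective (by omega))
    · obtain ⟨hC, hyC⟩ := hhb y hy
      generalize hb y = C at hC hyC
      have hxK := F.lev_lt_of_adj_hub hC hyC hx hadj
      by_cases hv : y = F.apex C
      · subst hv
        rw [col_apex C hC]
        refine col_ne_height C hC x hx hxK.le
          (fun C' hC' hr => hr.eq_of_adj_hub hC' hC hyC hadj) fun he => ?_
        have := F.lt_height C hC x hx hadj
        omega
      · rw [col_hub C hC y hyC hv]
        have := col_low_le x hx hxK
        omega
    · obtain ⟨hC, hxC⟩ := hhb x hx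
      generalize hb x = C at hC hxC
      have hyK := F.lev_le_of_hub_adj hC hxC hy hadj
      by_cases hv : x = F.apex C
      · subst hv
        rw [col_apex C hC]
        exact (col_ne_height C hC y hy hyK
          (fun C' hC' hr => hr.eq_of_hub_adj hC' hC hxC hadj) fun he => .base hy hadj he).symm
      · rw [col_hub C hC x hxC hv]
        rcases hyK.lt_or_eq with hyK | hyK
        · have := col_low_le y hy hyK
          omega
        · rw [col_mid y hy hyK]
          split_ifs with hr
          · have := hκ y hyK hr C hC x hxC hv hadj
            omega
          · omega
    · obtain ⟨hC, hxC⟩ := hhb x hx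
      obtain ⟨hC', hyC⟩ := hhb y hy
      generalize hb x = C at hC hxC
      generalize hb y = C' at hC' hyC
      obtain rfl := F.hub_eq_of_adj hC hxC hC' hyC hadj
      have hh := F.height_le hC
      by_cases hvx : x = F.apex C <;> by_cases hvy : y = F.apex C
      · exact absurd (hvx.trans hvy.symm ▸ hadj) (hloop _)
      · rw [hvx, col_apex C hC, col_hub C hC y hyC hvy]
        omega
      · rw [hvy, col_apex C hC, col_hub C hC x hxC hvx]
        omega
      · rw [col_hub C hC x hxC hvx, col_hub C hC y hyC hvy]
        intro he
        exact (F.isHub C hC).proper x hxC y hyC hvx hvy hadj (Fin.ext (by omega))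

/-! ### Existence of the hubs and the forest -/

theorem exists_hubForest [Finite V] [Nonempty V] {D : Digraph V} (hloop : ∀ x, ¬ D.Adj x x) {K L : ℕ}
    (hKL : K ≤ L) (hL : 1 ≤ L) (hfree : BlockFree D K L) : Nonempty (HubForest D K L) := by
  classical
  have := Fintype.ofFinite V
  let Good : Set (Set V) → Prop := fun H => (∀ C ∈ H, ∃ v f, IsHub D L C v f) ∧
    ∀ C ∈ H, ∀ C' ∈ H, ∀ x ∈ C, x ∈ C' → C = C'
  obtain ⟨H, hH⟩ := (Set.toFinite {H | Good H}).exists_maximal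
    ⟨∅, fun _ h => absurd h (Set.notMem_empty _), fun _ h => absurd h (Set.notMem_empty _)⟩
  have hgood : Good H := hH.1
  have hshort : ∀ M h, IsCircuit D (⋃₀ H)ᶜ M h → M ≤ L + 1 := by
    intro M h hc
    by_contra! hM
    obtain ⟨C, hCG, v, f, hC⟩ := exists_hub hloop hL ⟨M, hM, h, hc⟩
    have hdis : ∀ C' ∈ H, ∀ x ∈ C, x ∉ C' := fun C' hC' x hx hx' => hCG hx ⟨C', hC', hx'⟩
    have hins : Good (insert C H) := by
      refine ⟨?_, ?_⟩
      · rintro C' (rfl | hC')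
        · exact ⟨v, f, hC⟩
        · exact hgood.1 C' hC'
      · rintro C₁ (rfl | h₁) C₂ (rfl | h₂) x hx₁ hx₂
        · rfl
        · exact absurd hx₂ (hdis C₂ h₂ x hx₁)
        · exact absurd hx₁ (hdis C₁ h₁ x hx₂)
        · exact hgood.2 C₁ h₁ C₂ h₂ x hx₁ hx₂
    have hCH : C ∈ H := hH.2 hins (Set.subset_insert _ _) (Set.mem_insert _ _)
    exact hdis C hCH v hC.mem hC.mem
  obtain ⟨p, lev, hF, hfinal⟩ := exists_final_forest D (⋃₀ H)ᶜ
  have hhub : ∀ C, ∃ v f, C ∈ H → IsHub D L C v f := fun C => by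
    by_cases hC : C ∈ H
    · obtain ⟨v, f, h⟩ := hgood.1 C hC
      exact ⟨v, f, fun _ => h⟩
    · exact ⟨Classical.arbitrary V, fun _ => 0, fun h => absurd h hC⟩
  choose v f hvf using hhub
  have hheight : ∀ C, ∃ n, (∀ s ∈ (⋃₀ H)ᶜ, D.Adj s (v C) → lev s < n) ∧
      (n = 0 ∨ ∃ s ∈ (⋃₀ H)ᶜ, D.Adj s (v C) ∧ n = lev s + 1) := by
    intro C
    have hex : ∃ n, ∀ s ∈ (⋃₀ H)ᶜ, D.Adj s (v C) → lev s < n :=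
      ⟨Nat.card V, fun s hs _ => hF.lev_lt_card hs⟩
    refine ⟨Nat.find hex, Nat.find_spec hex, ?_⟩
    by_contra! hcon
    refine Nat.find_min hex (m := Nat.find hex - 1) (by omega) fun s hs hadj => ?_
    have h1 := Nat.find_spec hex s hs hadj
    have h2 := hcon.2 s hs hadj
    omega
  choose n hn hn' using hheight
  refine ⟨{ hubs := H, apex := v, shade := f, par := p, lev := lev, height := n, le := hKL
            free := hfree, isHub := hvf, eq_of_mem := hgood.2, isForest := hF, final := hfinal
            short := ?_, lt_height := fun C _ => hn C, height_eq := fun C _ => hn' C }⟩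
  intro x hx y hy hadj
  obtain ⟨t, ht, rfl⟩ := hy
  have h1 := (hF.iterate hx ht).2
  -- The tree path from the ancestor to `x`, closed by the back arc.
  have h2 := hshort (t + 1) (fun i => p^[t - i] x) ⟨by omega, ?_, ?_, ?_, ?_⟩
  · omega
  · exact fun i _ => (hF.iterate hx (by omega)).1
  · intro i hi j hj hij
    simp only [Set.mem_Iio] at hi hj
    have := hF.iterate_inj hx (by omega) (by omega) hij
    omega
  · intro i hi
    have := hF.adj_iterate hx (t := t - (i + 1)) (by omega)
    rwa [show t - (i + 1) + 1 = t - i by omega] at this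
  · simpa using hadj

/-! ### Finite digraphs, compactness and the theorem -/

/-- A finite digraph without two-block paths `P⁺(K + 1, L + 1)` is `(K + L + 2)`-colourable. -/
theorem exists_coloring_of_blockFree [Finite V] {D : Digraph V} (hloop : ∀ x, ¬ D.Adj x x)
    {K L : ℕ} (hKL : 1 ≤ K + L) (hfree : BlockFree D K L) :
    D.toSimpleGraphInclusive.Colorable (K + L + 2) := by
  have key : ∃ col : V → ℕ, (∀ x, col x < K + L + 2) ∧ ∀ x y, D.Adj x y → col x ≠ col y := by
    rcases isEmpty_or_nonempty V with hV | hV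
    · exact ⟨fun _ => 0, fun x => hV.elim x, fun x => hV.elim x⟩
    -- The larger of `K` and `L` is at least `1`, as hubs require; for `K = L = 0` the directed
    -- triangle is a counterexample.
    rcases le_total K L with h | h
    · obtain ⟨F⟩ := exists_hubForest hloop h (by omega) hfree
      exact F.exists_coloring hloop
    · obtain ⟨F⟩ := exists_hubForest hloop h (by omega) hfree.symm
      rw [Nat.add_comm K L]
      exact F.exists_coloring hloop
  obtain ⟨col, hlt, hne⟩ := key
  exact ⟨SimpleGraph.Coloring.mk (fun x => ⟨col x, hlt x⟩) fun {x y} hxy he => by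
    have he' : col x = col y := Fin.mk.inj he
    rcases hxy.2 with h | h
    · exact hne x y h he'
    · exact hne y x h he'.symm⟩

theorem EndsPath.map {W : Type*} {D : Digraph V} {E : Digraph W} {f : W → V}
    (hf : Function.Injective f) (hadj : ∀ x y, E.Adj x y → D.Adj (f x) (f y)) {n : ℕ} {S : Set W}
    {x : W} (h : EndsPath E n S x) : EndsPath D n (f '' S) (f x) := by
  induction n generalizing S x with
  | zero => exact Set.mem_image_of_mem f h
  | succ n ih =>
    obtain ⟨hx, w, hw, hp⟩ := h
    refine ⟨Set.mem_image_of_mem f hx, f w, hadj _ _ hw, (ih hp).mono ?_⟩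
    rw [Set.image_sdiff hf, Set.image_singleton]

theorem contains_pathPos_of_not_colorable {D : Digraph V} (hD : IsOriented D) {k l : ℕ}
    (hk : 1 ≤ k) (hl : 1 ≤ l) (hkl : 3 ≤ k + l)
    (hcol : ¬ D.toSimpleGraphInclusive.Colorable (k + l)) : Contains D (pathPos k l) := by
  obtain ⟨K, rfl⟩ := Nat.exists_eq_add_of_le' hk
  obtain ⟨L, rfl⟩ := Nat.exists_eq_add_of_le' hl
  by_contra hcon
  have hfree : BlockFree D K L := fun _ _ _ _ _ h₁ h₂ p₁ p₂ hST hS hT =>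
    hcon (contains_pathPos h₁ h₂ p₁ p₂ hST hS hT)
  -- De Bruijn–Erdős: it suffices to colour finite subgraphs.
  refine hcol (SimpleGraph.nonempty_hom_of_forall_finite_subgraph_hom fun G' hfin => ?_)
  have : Finite G'.verts := hfin
  let E : Digraph G'.verts := ⟨fun x y => D.Adj x y⟩
  have hEfree : BlockFree E K L := fun x₁ x₂ y S T h₁ h₂ p₁ p₂ hST hS hT =>
    hfree h₁ h₂ (p₁.map Subtype.val_injective fun _ _ h => h)
      (p₂.map Subtype.val_injective fun _ _ h => h)
      ((Set.disjoint_image_iff Subtype.val_injective).2 hST)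
      (fun h => hS ((Subtype.val_injective.mem_set_image).1 h))
      (fun h => hT ((Subtype.val_injective.mem_set_image).1 h))
  have hE := exists_coloring_of_blockFree (D := E) (fun x h => hD _ _ h h) (by omega) hEfree
  rw [show K + L + 2 = K + 1 + (L + 1) by omega] at hE
  exact hE.some.comp ⟨id, fun {x y} hxy =>
    ⟨hxy.ne, (G'.adj_sub hxy).2⟩⟩

end TwoBlock

theorem theorem3p6 {V : Type*} (D : Digraph V) (hD : TwoBlock.IsOriented D)
    (n k l : ℕ) (hk : 1 ≤ k) (hl : 1 ≤ l) (hkl : k + l + 1 = n) (hn : 4 ≤ n)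
    (hchi : TwoBlock.IsChromatic D n) :
    TwoBlock.Contains D (TwoBlock.pathPos k l) ∧ TwoBlock.Contains D (TwoBlock.pathNeg k l) := by
  have hcol : ¬ D.toSimpleGraphInclusive.Colorable (k + l) := by
    intro h
    have h1 := h.chromaticNumber_le
    rw [show D.toSimpleGraphInclusive.chromaticNumber = (n : ℕ∞) from hchi] at h1
    have h2 : n ≤ k + l := by exact_mod_cast h1
    omega
  refine ⟨TwoBlock.contains_pathPos_of_not_colorable hD hk hl (by omega) hcol, ?_⟩
  let E : Digraph V := ⟨fun x y => D.Adj y x⟩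
  have hE : E.toSimpleGraphInclusive = D.toSimpleGraphInclusive := by
    ext x y
    exact ⟨fun h => ⟨h.1, h.2.symm⟩, fun h => ⟨h.1, h.2.symm⟩⟩
  obtain ⟨f, hf, hadj⟩ := TwoBlock.contains_pathPos_of_not_colorable (D := E)
    (fun x y h h' => hD _ _ h h') hk hl (by omega) (hE ▸ hcol)
  exact ⟨f, hf, fun x y h => hadj y x h⟩
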